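/- Let $G=\sum_{j=0}^{\infty}\frac{(-1)^j}{(2j+1)^2}$ be Catalan's constant and let $\zeta$ be the Riemann zeta function. The series defining $G$ and the series $\sum_{n=1}^{\infty}\frac{1}{n(16n^2-1)^3}$ converge absolutely, the real number $$4\sum_{n=1}^{\infty}\frac{1}{n}\,\frac{1}{(16n^2-1)^3}-12\log 2-5G$$ equals $\frac{7}{4}\zeta(3)-15$, and this number is irrational. -/

import Mathlib

/-- Catalan's constant `G = β(2) = 1 - 1/3² + 1/5² - 1/7² + ⋯`, the value at `2` of the
Dirichlet beta function. -/
noncomputable def catalanConstant : ℝ :=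
  ∑' j : ℕ, (-1 : ℝ) ^ j / (2 * (j : ℝ) + 1) ^ 2

open Finset Filter Topology

/-! Partial fractions split the summand into reciprocals of odd cubes, odd squares with alternating
signs, and a harmonic part. These contribute `ζ(3)`, `G` and `log 2`, and the multiples of `G` and
`log 2` are exactly those subtracted in the statement (`hasSum_main`). What remains is Apéry's
theorem (`irrational_zetaThree`).

Write `a n` for `aperyDenom n` and `b n` for `aperyNum n`. Both satisfy one three-term recurrence,
proved by telescoping certificates. Its Casoratian is `6/(n+1)³`, so `b n / a n` increases strictly
to `ζ(3)`; moreover `0 < a n * ζ(3) - b n ≤ 6 / a n` for `n ≥ 20`, and `a (20 + n) ≥ 30^n`. On the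
arithmetic side `a n` and `2 lcm(1,…,n)³ b n` are integers, and `lcm(1,…,n) ≤ K * 3.1^n`. Since
`3.1³ < 30`, a rational `ζ(3)` would produce positive integers tending to `0`. -/

/-- The product `C(n,k) C(n+k,k)`, whose squares are the summands of the Apéry numbers. -/
noncomputable def aperyBinom (n k : ℕ) : ℝ := (n.choose k : ℝ) * ((n + k).choose k : ℝ)

lemma aperyBinom_zero_right (n : ℕ) : aperyBinom n 0 = 1 := by simp [aperyBinom]

lemma aperyBinom_eq_zero {n k : ℕ} (h : n < k) : aperyBinom n k = 0 := by
  simp [aperyBinom, Nat.choose_eq_zero_of_lt h]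

lemma aperyBinom_pos {n k : ℕ} (h : k ≤ n) : 0 < aperyBinom n k := by
  have h₁ := Nat.choose_pos h
  have h₂ : 0 < (n + k).choose k := Nat.choose_pos (by omega)
  unfold aperyBinom
  positivity

lemma cast_choose_succ_right (n k : ℕ) :
    ((k : ℝ) + 1) * (n.choose (k + 1) : ℝ) = ((n : ℝ) - k) * (n.choose k : ℝ) := by
  rcases le_or_gt k n with h | h
  · have := Nat.choose_succ_right_eq n k
    have h' : ((n.choose (k + 1) * (k + 1) : ℕ) : ℝ) = ((n.choose k * (n - k) : ℕ) : ℝ) := by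
      rw [this]
    push_cast [Nat.cast_sub h] at h'
    linarith
  · simp [Nat.choose_eq_zero_of_lt h, Nat.choose_eq_zero_of_lt (Nat.lt_succ_of_lt h)]

lemma cast_choose_succ_left (n k : ℕ) :
    ((n : ℝ) + 1 - k) * ((n + 1).choose k : ℝ) = ((n : ℝ) + 1) * (n.choose k : ℝ) := by
  rcases le_or_gt k (n + 1) with h | h
  · have h' : ((n.choose k * (n + 1) : ℕ) : ℝ) = (((n + 1).choose k * (n + 1 - k) : ℕ) : ℝ) := by
      rw [Nat.choose_mul_succ_eq]
    push_cast [Nat.cast_sub h] at h'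
    linarith
  · simp [Nat.choose_eq_zero_of_lt h, Nat.choose_eq_zero_of_lt (show n < k by omega)]

lemma aperyBinom_succ_left (n k : ℕ) :
    ((n : ℝ) + 1 - k) * aperyBinom (n + 1) k = ((n : ℝ) + 1 + k) * aperyBinom n k := by
  have h₁ := cast_choose_succ_left n k
  have h₂ := cast_choose_succ_left (n + k) k
  push_cast at h₂
  have h₃ : ((n : ℝ) + 1) ≠ 0 := by positivity
  rw [aperyBinom, aperyBinom, show n + 1 + k = n + k + 1 by ring]
  apply mul_left_cancel₀ h₃
  linear_combination ((n : ℝ) + 1) * ((n + k + 1).choose k : ℝ) * h₁ +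
    ((n : ℝ) + 1) * (n.choose k : ℝ) * h₂

lemma aperyBinom_succ_right (n k : ℕ) :
    ((k : ℝ) + 1) ^ 2 * aperyBinom n (k + 1) =
      ((n : ℝ) - k) * ((n : ℝ) + k + 1) * aperyBinom n k := by
  have h₁ := cast_choose_succ_right n k
  have h₂ : (((n + k + 1) * (n + k).choose k : ℕ) : ℝ) =
      (((n + k + 1).choose (k + 1) * (k + 1) : ℕ) : ℝ) := by
    rw [Nat.add_one_mul_choose_eq]
  push_cast at h₂
  rw [aperyBinom, aperyBinom, show n + (k + 1) = n + k + 1 by ring]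
  linear_combination ((k : ℝ) + 1) * ((n + k + 1).choose (k + 1) : ℝ) * h₁ -
    ((n : ℝ) - k) * (n.choose k : ℝ) * h₂

/-- The four neighbouring values of `aperyBinom` entering Apéry's recurrence are polynomial
multiples of a common factor. -/
lemma exists_aperyBinom_eq (n k : ℕ) : ∃ u : ℝ,
    aperyBinom (n + 1) k = ((k : ℝ) + 1) ^ 2 * u ∧
    aperyBinom n (k + 1) = ((n : ℝ) - k) * ((n : ℝ) + 1 - k) * u ∧
    aperyBinom (n + 1) (k + 1) = ((n : ℝ) + 1 - k) * ((n : ℝ) + k + 2) * u ∧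
    aperyBinom (n + 2) (k + 1) = ((n : ℝ) + k + 2) * ((n : ℝ) + k + 3) * u := by
  have hk : ((k : ℝ) + 1) ^ 2 ≠ 0 := by positivity
  have h₁ := aperyBinom_succ_left n k
  have h₂ := aperyBinom_succ_left (n + 1) k
  have h₃ := aperyBinom_succ_right n k
  have h₄ := aperyBinom_succ_right (n + 1) k
  have h₅ := aperyBinom_succ_right (n + 2) k
  push_cast at h₂ h₄ h₅
  -- Dividing only by `(k+1)²`, which never vanishes, keeps the four formulas valid where the
  -- binomials are zero.
  obtain ⟨u, hu⟩ : ∃ u, aperyBinom (n + 1) k = ((k : ℝ) + 1) ^ 2 * u :=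
    ⟨aperyBinom (n + 1) k / ((k : ℝ) + 1) ^ 2, by field_simp⟩
  refine ⟨u, hu, ?_, ?_, ?_⟩ <;> apply mul_left_cancel₀ hk
  · rw [hu] at h₁
    linear_combination h₃ - ((n : ℝ) - k) * h₁
  · rw [hu] at h₄
    linear_combination h₄
  · rw [show n + 1 + 1 = n + 2 from rfl, hu] at h₂
    linear_combination h₅ + ((n : ℝ) + 2 + k + 1) * h₂

/-! ### Apéry's denominators and numerators -/

/-- The truncated sums `∑_{m ≤ n} 1/m³ + ∑_{m ≤ k} (-1)^(m-1) / (2 m³ C(n,m) C(n+m,m))`. -/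
noncomputable def aperyWeight (n k : ℕ) : ℝ :=
  ∑ m ∈ range n, 1 / ((m : ℝ) + 1) ^ 3 +
    ∑ m ∈ range k, (-1 : ℝ) ^ m / (2 * ((m : ℝ) + 1) ^ 3 * aperyBinom n (m + 1))

/-- The Apéry numbers `∑ C(n,k)² C(n+k,k)²`. -/
noncomputable def aperyDenom (n : ℕ) : ℝ := ∑ k ∈ range (n + 1), aperyBinom n k ^ 2

/-- The numerators of Apéry's rational approximations to `ζ(3)`. -/
noncomputable def aperyNum (n : ℕ) : ℝ :=
  ∑ k ∈ range (n + 1), aperyBinom n k ^ 2 * aperyWeight n k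

lemma aperyWeight_succ_right (n k : ℕ) : aperyWeight n (k + 1) =
    aperyWeight n k + (-1 : ℝ) ^ k / (2 * ((k : ℝ) + 1) ^ 3 * aperyBinom n (k + 1)) := by
  rw [aperyWeight, aperyWeight, sum_range_succ _ k]
  ring

/-- The change of the weight in `n` telescopes in `k` to a single term; this is what lets all
weights in the recurrence be compared with one of them. -/
lemma aperyWeight_succ_left {n k : ℕ} (h : k ≤ n) : aperyWeight (n + 1) k =
    aperyWeight n k + (-1 : ℝ) ^ k / (((n : ℝ) + 1) ^ 2 * ((n : ℝ) + 1 + k) * aperyBinom n k) := by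
  induction k with
  | zero =>
    simp only [aperyWeight, sum_range_succ, range_zero, sum_empty, aperyBinom_zero_right]
    push_cast
    field_simp
    ring
  | succ k ih =>
    rw [aperyWeight_succ_right, aperyWeight_succ_right, ih (by omega)]
    have hkn : (k : ℝ) + 1 ≤ n := by exact_mod_cast h
    have ht := aperyBinom_pos (show k ≤ n by omega)
    have h₁ := aperyBinom_succ_left n (k + 1)
    have h₂ := aperyBinom_succ_right n k
    push_cast at h₁
    have e₁ : aperyBinom n (k + 1) =
        ((n : ℝ) - k) * ((n : ℝ) + k + 1) * aperyBinom n k / ((k : ℝ) + 1) ^ 2 := by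
      field_simp
      linarith
    have e₂ : aperyBinom (n + 1) (k + 1) =
        ((n : ℝ) + 1 + (k + 1)) * aperyBinom n (k + 1) / ((n : ℝ) - k) := by
      rw [eq_div_iff (by linarith)]
      linarith
    rw [e₂, e₁, pow_succ]
    have h₃ : (n : ℝ) - k ≠ 0 := by linarith
    push_cast
    field_simp
    ring

/-! ### The common recurrence by creative telescoping -/

/-- The middle coefficient of Apéry's recurrence. -/
noncomputable def aperyMid (x : ℝ) : ℝ := 34 * x ^ 3 + 51 * x ^ 2 + 27 * x + 5

lemma sum_range_eq_of_telescope {F A : ℕ → ℝ} {N : ℕ} (h₀ : F 0 = A 0)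
    (h : ∀ k < N, F (k + 1) = A (k + 1) - A k) : ∑ k ∈ range (N + 1), F k = A N := by
  induction N with
  | zero => simpa using h₀
  | succ N ih =>
    rw [sum_range_succ, ih fun k hk => h k (by omega), h N (by omega)]
    ring

/-- The certificate for the recurrence of the Apéry numbers. -/
noncomputable def aperyCert (n k : ℕ) : ℝ :=
  4 * (2 * (n : ℝ) + 1) * (k * (2 * (k : ℝ) + 1) - (2 * (n : ℝ) + 1) ^ 2) * aperyBinom n k ^ 2

/-- Each side is `u²` times a polynomial in `n` and `k`, with `u` the common factor from
`exists_aperyBinom_eq`. -/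
lemma aperyCert_telescope (n k : ℕ) :
    ((n : ℝ) + 2) ^ 3 * aperyBinom (n + 2) (k + 1) ^ 2
      - aperyMid (n + 1) * aperyBinom (n + 1) (k + 1) ^ 2
      + ((n : ℝ) + 1) ^ 3 * aperyBinom n (k + 1) ^ 2 =
    aperyCert (n + 1) (k + 1) - aperyCert (n + 1) k := by
  obtain ⟨u, h₁, h₂, h₃, h₄⟩ := exists_aperyBinom_eq n k
  simp only [aperyCert, aperyMid, h₁, h₂, h₃, h₄]
  push_cast
  ring

lemma sum_range_aperyBinom_extend {n N : ℕ} (h : n + 1 ≤ N) (f : ℕ → ℝ) :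
    ∑ k ∈ range (n + 1), aperyBinom n k ^ 2 * f k = ∑ k ∈ range N, aperyBinom n k ^ 2 * f k := by
  refine sum_subset (range_subset_range.2 h) fun k _ hk => ?_
  rw [aperyBinom_eq_zero (by simpa using hk)]
  simp

lemma aperyDenom_recurrence (n : ℕ) :
    ((n : ℝ) + 2) ^ 3 * aperyDenom (n + 2) - aperyMid (n + 1) * aperyDenom (n + 1)
      + ((n : ℝ) + 1) ^ 3 * aperyDenom n = 0 := by
  have e : ∀ m, m ≤ n + 2 → aperyDenom m = ∑ k ∈ range (n + 2 + 1), aperyBinom m k ^ 2 := by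
    intro m hm
    simpa [aperyDenom] using sum_range_aperyBinom_extend (show m + 1 ≤ n + 2 + 1 by omega) 1
  rw [e n (by omega), e (n + 1) (by omega), e (n + 2) le_rfl, mul_sum, mul_sum, mul_sum,
    ← sum_sub_distrib, ← sum_add_distrib,
    sum_range_eq_of_telescope (A := aperyCert (n + 1)) _ fun k _ => aperyCert_telescope n k]
  · rw [aperyCert, aperyBinom_eq_zero (by omega)]
    simp
  · simp only [aperyCert, aperyBinom_zero_right, aperyMid]
    push_cast
    ring

/-- The certificate for the recurrence of the numerators. -/
noncomputable def aperyNumCert (n k : ℕ) : ℝ :=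
  aperyCert n k * aperyWeight n k -
    5 * (2 * (n : ℝ) + 1) * (-1) ^ k * k / (n * ((n : ℝ) + 1)) * aperyBinom n k

/-- Once every weight is expressed through a single one, its total coefficient cancels by the
telescoping of `aperyCert`. The second term of `aperyNumCert` absorbs the leftover corrections. -/
lemma aperyNumCert_telescope {n k : ℕ} (hk : k ≤ n + 1) :
    ((n : ℝ) + 2) ^ 3 * (aperyBinom (n + 2) (k + 1) ^ 2 * aperyWeight (n + 2) (k + 1))
      - aperyMid (n + 1) * (aperyBinom (n + 1) (k + 1) ^ 2 * aperyWeight (n + 1) (k + 1))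
      + ((n : ℝ) + 1) ^ 3 * (aperyBinom n (k + 1) ^ 2 * aperyWeight n (k + 1)) =
    aperyNumCert (n + 1) (k + 1) - aperyNumCert (n + 1) k := by
  have key := aperyCert_telescope n k
  obtain ⟨u, h₁, h₂, h₃, h₄⟩ := exists_aperyBinom_eq n k
  have hu : u ≠ 0 := by
    rintro rfl
    have := aperyBinom_pos hk
    simp [h₁] at this
  have hw := aperyWeight_succ_right (n + 1) k
  rcases Nat.lt_or_ge n k with hnk | hnk
  · obtain rfl : k = n + 1 := by omega
    have hw₁ := aperyWeight_succ_left (le_refl (n + 1))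
    have hw₂ := aperyWeight_succ_right (n + 2) (n + 1)
    rw [show n + 1 + 1 = n + 2 from rfl] at *
    rw [aperyBinom_eq_zero (show n < n + 2 by omega), aperyBinom_eq_zero (show n + 1 < n + 2 by omega)]
    rw [h₄] at hw₂
    rw [h₁] at hw₁
    simp only [aperyNumCert, aperyCert, h₁, h₄, hw₂, hw₁,
      aperyBinom_eq_zero (show n + 1 < n + 2 by omega)]
    push_cast
    field_simp
    ring
  · have hnk' : (k : ℝ) ≤ n := by exact_mod_cast hnk
    have hp : (n : ℝ) + 1 - k ≠ 0 := by linarith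
    have hw₁ := aperyWeight_succ_left (show k + 1 ≤ n + 1 by omega)
    -- The binomial factor is kept because at `k = n` it vanishes, whereas the formula for the
    -- weight itself is not available there.
    have hw₂ : aperyBinom n (k + 1) ^ 2 * aperyWeight n (k + 1) =
        aperyBinom n (k + 1) ^ 2 * aperyWeight (n + 1) (k + 1) + aperyBinom n (k + 1) *
          ((-1 : ℝ) ^ k / (((n : ℝ) + 1) ^ 2 * ((n : ℝ) + k + 2))) := by
      rcases hnk.lt_or_eq with h | rfl
      · have ht := aperyBinom_pos (show k + 1 ≤ n from h)
        rw [aperyWeight_succ_left (show k + 1 ≤ n from h), pow_succ]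
        push_cast
        field_simp
        ring
      · rw [aperyBinom_eq_zero (Nat.lt_succ_self k)]
        simp
    rw [hw₂]
    rw [show n + 1 + 1 = n + 2 from rfl] at hw₁
    have hw₃ : aperyWeight (n + 1) k = aperyWeight (n + 1) (k + 1) -
        (-1 : ℝ) ^ k / (2 * ((k : ℝ) + 1) ^ 3 * aperyBinom (n + 1) (k + 1)) := by
      rw [hw]
      ring
    simp only [aperyNumCert, hw₁, hw₃]
    have : aperyCert (n + 1) (k + 1) = ((n : ℝ) + 2) ^ 3 * aperyBinom (n + 2) (k + 1) ^ 2
      - aperyMid (n + 1) * aperyBinom (n + 1) (k + 1) ^ 2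
      + ((n : ℝ) + 1) ^ 3 * aperyBinom n (k + 1) ^ 2 + aperyCert (n + 1) k := by linarith
    rw [this]
    simp only [aperyCert, h₁, h₂, h₃, h₄, pow_succ (-1 : ℝ) k]
    push_cast
    field_simp
    ring

lemma aperyNum_recurrence (n : ℕ) :
    ((n : ℝ) + 2) ^ 3 * aperyNum (n + 2) - aperyMid (n + 1) * aperyNum (n + 1)
      + ((n : ℝ) + 1) ^ 3 * aperyNum n = 0 := by
  have e : ∀ m, m ≤ n + 2 →
      aperyNum m = ∑ k ∈ range (n + 2 + 1), aperyBinom m k ^ 2 * aperyWeight m k := fun m hm =>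
    sum_range_aperyBinom_extend (show m + 1 ≤ n + 2 + 1 by omega) _
  rw [e n (by omega), e (n + 1) (by omega), e (n + 2) le_rfl, mul_sum, mul_sum, mul_sum,
    ← sum_sub_distrib, ← sum_add_distrib,
    sum_range_eq_of_telescope (A := aperyNumCert (n + 1)) _
      fun k hk => aperyNumCert_telescope (Nat.lt_succ_iff.1 hk)]
  · rw [aperyNumCert, aperyCert, aperyBinom_eq_zero (by omega)]
    simp
  · simp only [aperyNumCert, aperyCert, aperyBinom_zero_right, aperyMid, aperyWeight,
      sum_range_succ, range_zero, sum_empty]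
    push_cast
    field_simp
    ring

/-! ### Casoratian and growth -/

lemma aperyDenom_pos (n : ℕ) : 0 < aperyDenom n :=
  sum_pos (fun k hk => pow_pos (aperyBinom_pos (Nat.lt_succ_iff.1 (mem_range.1 hk))) 2) ⟨0, by simp⟩

lemma aperyNum_mul_sub_mul_aperyDenom (n : ℕ) :
    aperyNum (n + 1) * aperyDenom n - aperyNum n * aperyDenom (n + 1) =
      6 / ((n : ℝ) + 1) ^ 3 := by
  induction n with
  | zero =>
    simp [aperyNum, aperyDenom, aperyBinom, aperyWeight, sum_range_succ]
    norm_num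
  | succ n ih =>
    have h₁ := aperyDenom_recurrence n
    have h₂ := aperyNum_recurrence n
    rw [eq_div_iff (by positivity)] at ih ⊢
    push_cast
    rw [show n + 1 + 1 = n + 2 from rfl]
    linear_combination ih + aperyDenom (n + 1) * h₂ - aperyNum (n + 1) * h₁

lemma aperyBinom_le_succ (n k : ℕ) : aperyBinom n k ≤ aperyBinom (n + 1) k := by
  unfold aperyBinom
  gcongr <;> omega

lemma aperyDenom_le_succ (n : ℕ) : aperyDenom n ≤ aperyDenom (n + 1) := by
  rw [aperyDenom, aperyDenom, sum_range_succ _ (n + 1)]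
  refine (sum_le_sum fun k _ => ?_).trans (le_add_of_nonneg_right (sq_nonneg _))
  have : 0 ≤ aperyBinom n k := by unfold aperyBinom; positivity
  exact pow_le_pow_left₀ this (aperyBinom_le_succ n k) 2

/-- By monotonicity the recurrence bounds the ratio below by a quantity tending to `34 - 1 = 33`,
which already exceeds `30` in this range. -/
lemma mul_aperyDenom_le_succ {n : ℕ} (hn : 20 ≤ n) :
    30 * aperyDenom n ≤ aperyDenom (n + 1) := by
  obtain ⟨m, rfl⟩ : ∃ m, n = m + 1 := ⟨n - 1, by omega⟩
  have h₁ := aperyDenom_recurrence m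
  have h₂ := aperyDenom_le_succ m
  have h₃ := aperyDenom_pos (m + 1)
  have hm : (19 : ℝ) ≤ m := by exact_mod_cast (by omega : 19 ≤ m)
  have h₄ : 30 * ((m : ℝ) + 2) ^ 3 + ((m : ℝ) + 1) ^ 3 ≤ aperyMid (m + 1) := by
    obtain ⟨x, hx⟩ : ∃ x : ℝ, (m : ℝ) = 19 + x := ⟨m - 19, by ring⟩
    have hx0 : 0 ≤ x := by linarith
    rw [hx, aperyMid, ← sub_nonneg]
    ring_nf
    positivity
  have h₅ : ((m : ℝ) + 1) ^ 3 * aperyDenom m ≤ ((m : ℝ) + 1) ^ 3 * aperyDenom (m + 1) := by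
    gcongr
  have h₆ := mul_le_mul_of_nonneg_right h₄ h₃.le
  have h₇ : 0 < ((m : ℝ) + 2) ^ 3 := by positivity
  refine le_of_mul_le_mul_left ?_ h₇
  rw [show m + 1 + 1 = m + 2 from rfl]
  linarith

/-! ### Chebyshev-type bounds and divisibility for `lcm(1, …, n)` -/

namespace Nat

lemma log_eq_card_filter_pow_le {p n b : ℕ} (hp : 1 < p) (hb : log p n < b) :
    log p n = #{i ∈ Ico 1 b | p ^ i ≤ n} := by
  rcases n.eq_zero_or_pos with rfl | hn
  · simp [show p ≠ 0 by omega]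
  have : {i ∈ Ico 1 b | p ^ i ≤ n} = Ico 1 (log p n + 1) := by
    ext i
    simp only [mem_filter, mem_Ico, ← le_log_iff_pow_le hp hn.ne']
    omega
  rw [this]
  simp

/-- Compare exponents prime by prime. As `1/2 + 1/3 + 1/7 + 1/42 = 1`, the integer `j - ⌊j/2⌋ -
⌊j/3⌋ - ⌊j/7⌋ - ⌊j/42⌋` is nonnegative, and it is at least `1` for `1 ≤ j < 42`. -/
lemma lcmUpto_mul_factorial_dvd (q : ℕ) :
    lcmUpto (42 * q) * ((21 * q).factorial * (14 * q).factorial * (6 * q).factorial * q.factorial) ∣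
      lcmUpto q * (42 * q).factorial := by
  have hf := factorial_ne_zero
  have hl := lcmUpto_ne_zero
  rw [← factorization_prime_le_iff_dvd (by simp [hf, hl]) (by simp [hf, hl])]
  intro p hp
  obtain ⟨b, hb⟩ : ∃ b, log p (42 * q) < b := ⟨_, lt_succ_self _⟩
  have hlog : ∀ c, c ≤ 42 * q → log p c < b := fun c hc => (log_mono_right hc).trans_lt hb
  simp only [factorization_mul, hf, hl, mul_ne_zero_iff, ne_eq, not_false_eq_true, and_self,
    Finsupp.add_apply, factorization_lcmUpto _ hp]
  rw [factorization_factorial hp (hlog (21 * q) (by omega)),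
    factorization_factorial hp (hlog (14 * q) (by omega)),
    factorization_factorial hp (hlog (6 * q) (by omega)),
    factorization_factorial hp (hlog q (by omega)), factorization_factorial hp hb,
    log_eq_card_filter_pow_le hp.one_lt hb, log_eq_card_filter_pow_le hp.one_lt (hlog q (by omega)),
    card_filter, card_filter, ← sum_add_distrib, ← sum_add_distrib, ← sum_add_distrib,
    ← sum_add_distrib, ← sum_add_distrib]
  refine sum_le_sum fun i _ => ?_
  have hP : 0 < p ^ i := pow_pos hp.pos i
  generalize p ^ i = P at hP
  have h₂ : 21 * q / P = 42 * q / P / 2 := by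
    rw [Nat.div_right_comm]; congr 1; omega
  have h₃ : 14 * q / P = 42 * q / P / 3 := by
    rw [Nat.div_right_comm]; congr 1; omega
  have h₇ : 6 * q / P = 42 * q / P / 7 := by
    rw [Nat.div_right_comm]; congr 1; omega
  have h₄₂ : q / P = 42 * q / P / 42 := by
    rw [Nat.div_right_comm]; congr 1; omega
  have e₁ : P ≤ 42 * q ↔ 1 ≤ 42 * q / P := by rw [Nat.le_div_iff_mul_le hP, one_mul]
  have e₂ : P ≤ q ↔ 1 ≤ 42 * q / P / 42 := by rw [← h₄₂, Nat.le_div_iff_mul_le hP, one_mul]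
  rw [h₂, h₃, h₇, h₄₂]
  simp only [e₁, e₂]
  generalize 42 * q / P = j
  split_ifs <;> omega

lemma factorial_add_mul_pow_le (a b x y : ℕ) :
    (a + b).factorial * (x ^ a * y ^ b) ≤ (x + y) ^ (a + b) * (a.factorial * b.factorial) := by
  have h : x ^ a * y ^ b * (a + b).choose a ≤ (x + y) ^ (a + b) := by
    rw [add_pow]
    have := single_le_sum (f := fun m => x ^ m * y ^ (a + b - m) * (a + b).choose m)
      (fun _ _ => Nat.zero_le _) (show a ∈ range (a + b + 1) by simp)
    simpa using this
  calc (a + b).factorial * (x ^ a * y ^ b)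
      = x ^ a * y ^ b * (a + b).choose a * (a.factorial * b.factorial) := by
        rw [← Nat.add_choose_mul_factorial_mul_factorial, Nat.choose_symm_add]; ring
    _ ≤ _ := by gcongr

/-- Entropy bound for a multinomial coefficient, split as `42 = 21 + 21`, `21 = 14 + 7`, `7 = 6 +
1`. The constant is `42^42 / (21^21 * 14^14 * 6^6)`. -/
lemma factorial_mul_le (q : ℕ) : (42 * q).factorial ≤
    (2 ^ 21 * 3 ^ 14 * 7 ^ 6 * 42) ^ q *
      ((21 * q).factorial * (14 * q).factorial * (6 * q).factorial * q.factorial) := by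
  have h₁ := factorial_add_mul_pow_le (21 * q) (21 * q) 21 21
  have h₂ := factorial_add_mul_pow_le (14 * q) (7 * q) 14 7
  have h₃ := factorial_add_mul_pow_le (6 * q) q 6 1
  rw [show 21 * q + 21 * q = 42 * q by ring] at h₁
  rw [show 14 * q + 7 * q = 21 * q by ring] at h₂
  rw [show 6 * q + q = 7 * q by ring] at h₃
  simp only [pow_mul, one_pow, mul_one, Nat.reduceAdd, ← mul_pow] at h₁ h₂ h₃
  have h := Nat.mul_le_mul (Nat.mul_le_mul h₁ h₂) h₃
  have hc : 0 < (21 * q).factorial * (7 * q).factorial *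
      ((21 ^ 21) ^ q * (21 ^ 21) ^ q * (7 ^ 7) ^ q * ((14 ^ 14) ^ q * (6 ^ 6) ^ q)) := by positivity
  refine Nat.le_of_mul_le_mul_left ?_ hc
  calc _ = _ := ?_
    _ ≤ _ := h
    _ = _ := ?_
  · simp only [mul_pow]; ring
  · have e : (42 ^ 42) ^ q = ((2 ^ 21 * 3 ^ 14 * 7 ^ 6 * 42) ^ q * (21 ^ 21) ^ q *
        ((14 ^ 14) ^ q * (6 ^ 6) ^ q) : ℕ) := by
      simp only [← mul_pow]; norm_num
    rw [e]; ring

lemma lcmUpto_mul_le (q : ℕ) :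
    lcmUpto (42 * q) ≤ lcmUpto q * (2 ^ 21 * 3 ^ 14 * 7 ^ 6 * 42) ^ q := by
  have h := Nat.le_of_dvd (mul_pos (lcmUpto_pos q) (factorial_pos _)) (lcmUpto_mul_factorial_dvd q)
  refine Nat.le_of_mul_le_mul_right (h.trans ?_)
    (show 0 < (21 * q).factorial * (14 * q).factorial * (6 * q).factorial * q.factorial by positivity)
  rw [mul_assoc]
  exact Nat.mul_le_mul_left _ (factorial_mul_le q)

lemma dvd_lcmUpto {m n : ℕ} (hm : 1 ≤ m) (hmn : m ≤ n) : m ∣ lcmUpto n :=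
  dvd_lcm (f := id) (mem_Icc.2 ⟨hm, hmn⟩)

lemma lcmUpto_dvd_lcmUpto {m n : ℕ} (h : m ≤ n) : lcmUpto m ∣ lcmUpto n :=
  Finset.lcm_dvd fun _ hi => dvd_lcmUpto (mem_Icc.1 hi).1 ((mem_Icc.1 hi).2.trans h)

lemma lcmUpto_le_of_le {b c : ℝ} (hc : 1 ≤ c)
    (hbc : b * (2 ^ 21 * 3 ^ 14 * 7 ^ 6 * 42) ≤ c ^ 42) (hb : 0 ≤ b)
    (h : ∃ K : ℝ, 0 ≤ K ∧ ∀ n, (lcmUpto n : ℝ) ≤ K * b ^ n) :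
    ∃ K : ℝ, 0 ≤ K ∧ ∀ n, (lcmUpto n : ℝ) ≤ K * c ^ n := by
  obtain ⟨K, hK, h⟩ := h
  refine ⟨K * c ^ 42, by positivity, fun n => ?_⟩
  obtain ⟨q, hq₁, hq₂⟩ : ∃ q, n ≤ 42 * q ∧ 42 * q ≤ n + 42 := ⟨n / 42 + 1, by omega, by omega⟩
  calc (lcmUpto n : ℝ) ≤ lcmUpto (42 * q) := by
        exact_mod_cast Nat.le_of_dvd (lcmUpto_pos _) (lcmUpto_dvd_lcmUpto hq₁)
    _ ≤ lcmUpto q * (2 ^ 21 * 3 ^ 14 * 7 ^ 6 * 42) ^ q := by exact_mod_cast lcmUpto_mul_le q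
    _ ≤ K * b ^ q * (2 ^ 21 * 3 ^ 14 * 7 ^ 6 * 42) ^ q := by gcongr; exact h q
    _ = K * (b * (2 ^ 21 * 3 ^ 14 * 7 ^ 6 * 42)) ^ q := by rw [mul_pow b]; ring
    _ ≤ K * (c ^ 42) ^ q := by gcongr
    _ = K * c ^ (42 * q) := by rw [pow_mul]
    _ ≤ K * c ^ (n + 42) := by gcongr
    _ = K * c ^ 42 * c ^ n := by ring

lemma lcmUpto_le_pow (n : ℕ) : (lcmUpto n : ℝ) ≤ 220 ^ n := by
  -- The base `220 = 4 * 55` bounds `exp (log 4 + 4)`.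
  have h := Chebyshev.psi_le_const_mul_self (Nat.cast_nonneg n)
  rw [Chebyshev.psi_eq_log_lcmUpto,
    Real.log_le_iff_le_exp (by exact_mod_cast lcmUpto_pos n), mul_comm, Real.exp_nat_mul,
    Real.exp_add, Real.exp_log (by norm_num)] at h
  refine h.trans ?_
  have he : Real.exp 4 ≤ 55 := by
    rw [show (4 : ℝ) = (4 : ℕ) * 1 by norm_num, Real.exp_nat_mul]
    have := Real.exp_one_lt_d9
    calc Real.exp 1 ^ 4 ≤ 2.7182818286 ^ 4 := by gcongr
      _ ≤ 55 := by norm_num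
  gcongr
  linarith

/-- A Chebyshev-type bound for `lcm(1, …, n)`. -/
lemma exists_lcmUpto_le : ∃ K : ℝ, 0 ≤ K ∧ ∀ n, (lcmUpto n : ℝ) ≤ K * (31 / 10) ^ n := by
  -- A pass turns base `b` into roughly `2.944 * b^(1/42)`; two passes, `220` to `3.4` to `3.1`,
  -- suffice.
  refine lcmUpto_le_of_le (b := 34 / 10) (by norm_num) (by norm_num) (by norm_num) ?_
  refine lcmUpto_le_of_le (b := 220) (by norm_num) (by norm_num) (by norm_num) ?_
  exact ⟨1, zero_le_one, fun n => by simpa using lcmUpto_le_pow n⟩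

/-- Leibniz's harmonic triangle: the reciprocals of `(k+1) * C(n+1,k+1)` in one column are
differences of those in the previous column, so `D` clears them all by induction. -/
lemma mul_choose_dvd_of_forall_dvd {D : ℕ} (k : ℕ) : ∀ n, k ≤ n →
    (∀ j, 1 ≤ j → j ≤ n + 1 → j ∣ D) → (k + 1) * (n + 1).choose (k + 1) ∣ D := by
  induction k with
  | zero =>
    intro n _ h
    simpa using h (n + 1) (by omega) le_rfl
  | succ k ih =>
    intro n hk h
    obtain ⟨n, rfl⟩ : ∃ m, n = m + 1 := ⟨n - 1, by omega⟩
    obtain ⟨x, hx⟩ := ih (n + 1) (by omega) h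
    obtain ⟨y, hy⟩ := ih n (by omega) fun j h₁ h₂ => h j h₁ (by omega)
    have e₁ : ((n + 2).choose (k + 2) : ℝ) * (k + 2) = (n + 2).choose (k + 1) * (n + 1 - k) := by
      have := cast_choose_succ_right (n + 2) (k + 1)
      push_cast at this
      linarith
    have e₂ := cast_choose_succ_left (n + 1) (k + 1)
    push_cast at e₂
    have hc : (0 : ℝ) < (n + 2).choose (k + 1) := by exact_mod_cast Nat.choose_pos (by omega)
    have hx' : (D : ℝ) = (k + 1) * (n + 2).choose (k + 1) * x := by exact_mod_cast hx
    have hy' : (D : ℝ) = (k + 1) * (n + 1).choose (k + 1) * y := by exact_mod_cast hy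
    have key : (D : ℝ) = (k + 1 + 1) * (n + 2).choose (k + 2) * ((y : ℝ) - x) := by
      have h₁ : (D : ℝ) * (n + 2) = (k + 1) * (n + 2).choose (k + 1) * (n + 1 - k) * y := by
        rw [hy']
        linear_combination -((k : ℝ) + 1) * y * e₂
      have h₂ : (k + 1 : ℝ) ≠ 0 := by positivity
      apply mul_left_cancel₀ h₂
      linear_combination h₁ - ((n : ℝ) + 1 - k) * hx' - ((k : ℝ) + 1) * (y - x) * e₁
    have : ((k + 1 + 1) * (n + 1 + 1).choose (k + 1 + 1) : ℤ) ∣ (D : ℤ) :=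
      ⟨(y : ℤ) - x, by exact_mod_cast key⟩
    exact_mod_cast this

lemma mul_choose_dvd_lcmUpto {m n : ℕ} (hm : 1 ≤ m) (hmn : m ≤ n) :
    m * n.choose m ∣ lcmUpto n := by
  obtain ⟨k, rfl⟩ : ∃ k, m = k + 1 := ⟨m - 1, by omega⟩
  obtain ⟨l, rfl⟩ : ∃ l, n = l + 1 := ⟨n - 1, by omega⟩
  exact mul_choose_dvd_of_forall_dvd k l (by omega) fun j h₁ h₂ => dvd_lcmUpto h₁ h₂

end Nat

/-! ### Convergence to `ζ(3)` and the error bound -/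

lemma summable_one_div_succ_pow {p : ℕ} (hp : 1 < p) :
    Summable fun m : ℕ => 1 / ((m : ℝ) + 1) ^ p := by
  have h := (summable_nat_add_iff 1).2 (Real.summable_one_div_nat_pow.2 hp)
  simpa using h

/-- The real number `ζ(3) = ∑ 1/m³`. -/
noncomputable def zetaThree : ℝ := ∑' m : ℕ, 1 / ((m : ℝ) + 1) ^ 3

lemma succ_le_aperyBinom {n k : ℕ} (hk : k + 1 ≤ n) : (n : ℝ) + 1 ≤ aperyBinom n (k + 1) := by
  have h₁ : 1 ≤ n.choose (k + 1) := Nat.choose_pos hk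
  have h₂ : n + 1 ≤ (n + (k + 1)).choose (k + 1) := by
    rw [Nat.choose_symm_add.symm]
    calc n + 1 = (n + 1).choose n := (Nat.choose_succ_self_right n).symm
      _ ≤ _ := Nat.choose_le_choose n (by omega)
  have h₃ := Nat.mul_le_mul h₁ h₂
  rw [one_mul] at h₃
  rw [aperyBinom]
  exact_mod_cast h₃

lemma abs_aperyWeight_sub_le {n k : ℕ} (hk : k ≤ n) :
    |aperyWeight n k - ∑ m ∈ range n, 1 / ((m : ℝ) + 1) ^ 3| ≤ zetaThree / (n + 1) := by
  rw [aperyWeight, add_sub_cancel_left]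
  calc |∑ m ∈ range k, (-1 : ℝ) ^ m / (2 * ((m : ℝ) + 1) ^ 3 * aperyBinom n (m + 1))|
      ≤ ∑ m ∈ range k, |(-1 : ℝ) ^ m / (2 * ((m : ℝ) + 1) ^ 3 * aperyBinom n (m + 1))| :=
        abs_sum_le_sum_abs _ _
    _ ≤ ∑ m ∈ range k, 1 / ((m : ℝ) + 1) ^ 3 / (n + 1) := by
        refine sum_le_sum fun m hm => ?_
        have h := succ_le_aperyBinom (show m + 1 ≤ n by have := mem_range.1 hm; omega)
        have hn : (0 : ℝ) < (n : ℝ) + 1 := by positivity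
        have hb : 0 < aperyBinom n (m + 1) := hn.trans_le h
        rw [abs_div, abs_pow, abs_neg, abs_one, one_pow, div_div, abs_of_pos (by positivity)]
        refine one_div_le_one_div_of_le (by positivity) ?_
        calc ((m : ℝ) + 1) ^ 3 * (n + 1) ≤ ((m : ℝ) + 1) ^ 3 * aperyBinom n (m + 1) := by gcongr
          _ ≤ 2 * (((m : ℝ) + 1) ^ 3 * aperyBinom n (m + 1)) :=
            le_mul_of_one_le_left (by positivity) one_le_two
          _ = _ := by ring
    _ = (∑ m ∈ range k, 1 / ((m : ℝ) + 1) ^ 3) / (n + 1) := by rw [sum_div]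
    _ ≤ zetaThree / (n + 1) := by
        gcongr
        exact (summable_one_div_succ_pow (by norm_num)).sum_le_tsum _ fun _ _ => by positivity

/-- The quotient is a weighted mean of `aperyWeight n k` over `k ≤ n`, all uniformly close to the
partial sum of `ζ(3)`. -/
lemma tendsto_aperyNum_div_aperyDenom :
    Tendsto (fun n => aperyNum n / aperyDenom n) atTop (𝓝 zetaThree) := by
  have h₁ : Tendsto (fun n => ∑ m ∈ range n, 1 / ((m : ℝ) + 1) ^ 3) atTop (𝓝 zetaThree) :=
    (summable_one_div_succ_pow (by norm_num)).hasSum.tendsto_sum_nat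
  have h₂ : Tendsto (fun n : ℕ => zetaThree / ((n : ℝ) + 1)) atTop (𝓝 0) := by
    have := (tendsto_one_div_add_atTop_nhds_zero_nat (𝕜 := ℝ)).const_mul zetaThree
    simpa [div_eq_mul_inv] using this
  have h₃ : Tendsto (fun n => aperyNum n / aperyDenom n - ∑ m ∈ range n, 1 / ((m : ℝ) + 1) ^ 3)
      atTop (𝓝 0) := by
    refine squeeze_zero_norm (fun n => ?_) h₂
    have ha := aperyDenom_pos n
    have e : aperyNum n / aperyDenom n - ∑ m ∈ range n, 1 / ((m : ℝ) + 1) ^ 3 =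
        (∑ k ∈ range (n + 1), aperyBinom n k ^ 2 *
          (aperyWeight n k - ∑ m ∈ range n, 1 / ((m : ℝ) + 1) ^ 3)) / aperyDenom n := by
      rw [eq_div_iff ha.ne', sub_mul, div_mul_cancel₀ _ ha.ne']
      simp only [mul_sub, sum_sub_distrib, ← sum_mul]
      rw [aperyNum, aperyDenom]
      ring
    rw [e, Real.norm_eq_abs, abs_div, abs_of_pos ha, div_le_iff₀ ha, aperyDenom, mul_sum]
    refine (abs_sum_le_sum_abs _ _).trans (sum_le_sum fun k hk => ?_)
    rw [abs_mul, abs_of_nonneg (sq_nonneg _), mul_comm]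
    gcongr
    exact abs_aperyWeight_sub_le (Nat.lt_succ_iff.1 (mem_range.1 hk))
  simpa using h₃.add h₁

lemma aperyNum_div_succ_sub (n : ℕ) :
    aperyNum (n + 1) / aperyDenom (n + 1) - aperyNum n / aperyDenom n =
      6 / (((n : ℝ) + 1) ^ 3 * (aperyDenom n * aperyDenom (n + 1))) := by
  have h := aperyNum_mul_sub_mul_aperyDenom n
  have h₁ := aperyDenom_pos n
  have h₂ := aperyDenom_pos (n + 1)
  rw [div_sub_div _ _ h₂.ne' h₁.ne', mul_comm (aperyDenom (n + 1)) (aperyNum n), h, div_div,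
    mul_comm (aperyDenom (n + 1))]

lemma strictMono_aperyNum_div : StrictMono fun n => aperyNum n / aperyDenom n := by
  refine strictMono_nat_of_lt_succ fun n => sub_pos.1 ?_
  rw [aperyNum_div_succ_sub]
  have h₁ := aperyDenom_pos n
  have h₂ := aperyDenom_pos (n + 1)
  positivity

lemma aperyNum_lt (n : ℕ) : aperyNum n < aperyDenom n * zetaThree := by
  have h := (strictMono_aperyNum_div (Nat.lt_succ_self n)).trans_le
    (strictMono_aperyNum_div.monotone.ge_of_tendsto tendsto_aperyNum_div_aperyDenom (n + 1))
  rwa [div_lt_iff₀ (aperyDenom_pos n), mul_comm] at h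

lemma one_le_aperyDenom (n : ℕ) : 1 ≤ aperyDenom n := by
  have := single_le_sum (f := fun k => aperyBinom n k ^ 2) (fun _ _ => sq_nonneg _)
    (show 0 ∈ range (n + 1) by simp)
  simpa [aperyBinom_zero_right, aperyDenom] using this

lemma pow_le_aperyDenom (n : ℕ) : (30 : ℝ) ^ n ≤ aperyDenom (20 + n) := by
  induction n with
  | zero => simpa using one_le_aperyDenom 20
  | succ n ih =>
    have := mul_aperyDenom_le_succ (show 20 ≤ 20 + n by omega)
    rw [← add_assoc, pow_succ]
    linarith

lemma aperyDenom_mul_zetaThree_sub_le {n : ℕ} (hn : 20 ≤ n) :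
    aperyDenom n * zetaThree - aperyNum n ≤ 6 / aperyDenom n := by
  -- The increment of `b n / a n` is at most `6/(a n * a (n+1))`, hence at most `6/(a n)² - 6/(a
  -- (n+1))²` by the growth of `a`.
  have hanti : Antitone fun m =>
      aperyNum (m + n) / aperyDenom (m + n) + 6 / aperyDenom (m + n) ^ 2 := by
    refine antitone_nat_of_succ_le fun m => ?_
    have h := aperyNum_div_succ_sub (m + n)
    have h₁ := mul_aperyDenom_le_succ (show 20 ≤ m + n by omega)
    have ha := aperyDenom_pos (m + n)
    have hb := aperyDenom_pos (m + n + 1)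
    rw [show m + 1 + n = m + n + 1 by ring]
    generalize aperyDenom (m + n) = a at *
    generalize aperyDenom (m + n + 1) = b at *
    have h₂ : 6 / ((((m + n : ℕ) : ℝ) + 1) ^ 3 * (a * b)) ≤ 6 / (a * b) := by
      refine div_le_div_of_nonneg_left (by norm_num) (by positivity)
        (le_mul_of_one_le_left (by positivity) (one_le_pow₀ ?_))
      exact le_add_of_nonneg_left (by positivity)
    have h₃ : 6 / (a * b) ≤ 6 / a ^ 2 - 6 / b ^ 2 := by
      rw [div_sub_div _ _ (by positivity) (by positivity), div_le_div_iff₀ (by positivity) (by positivity)]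
      have : 0 ≤ b ^ 2 - a ^ 2 - a * b := by nlinarith
      have := mul_nonneg (mul_pos ha hb).le this
      nlinarith
    linarith
  have hlim : Tendsto (fun m =>
      aperyNum (m + n) / aperyDenom (m + n) + 6 / aperyDenom (m + n) ^ 2) atTop (𝓝 zetaThree) := by
    have h₁ := (tendsto_add_atTop_iff_nat n).2 tendsto_aperyNum_div_aperyDenom
    have h₂ : Tendsto (fun m : ℕ => 6 / aperyDenom (m + n) ^ 2) atTop (𝓝 0) := by
      refine tendsto_const_nhds.div_atTop ((tendsto_pow_atTop two_ne_zero).comp ?_)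
      refine (tendsto_add_atTop_iff_nat n).2 ((tendsto_add_atTop_iff_nat 20).1 ?_)
      refine tendsto_atTop_mono (fun m => ?_) (tendsto_pow_atTop_atTop_of_one_lt
        (show (1 : ℝ) < 30 by norm_num))
      rw [add_comm]
      exact pow_le_aperyDenom m
    simpa using h₁.add h₂
  have h := hanti.le_of_tendsto hlim 0
  have ha := aperyDenom_pos n
  simp only [zero_add] at h
  have h' := mul_le_mul_of_nonneg_left h ha.le
  have e : aperyDenom n * (aperyNum n / aperyDenom n + 6 / aperyDenom n ^ 2) =
      aperyNum n + 6 / aperyDenom n := by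
    field_simp
  linarith

/-! ### Integrality and Apéry's theorem -/

lemma exists_int_lcmUpto_mul_div {n k m : ℕ} (hm : m < k) (hk : k ≤ n) :
    ∃ z : ℤ, (Nat.lcmUpto n : ℝ) ^ 3 * ((n + k).choose k /
      (((m : ℝ) + 1) ^ 3 * aperyBinom n (m + 1))) = z := by
  obtain ⟨x, hx⟩ := Nat.dvd_lcmUpto (show 1 ≤ m + 1 by omega) (show m + 1 ≤ n by omega)
  obtain ⟨y, hy⟩ := Nat.mul_choose_dvd_lcmUpto (show 1 ≤ m + 1 by omega) (show m + 1 ≤ n by omega)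
  obtain ⟨w, hw⟩ := (Nat.mul_choose_dvd_lcmUpto (show 1 ≤ m + 1 by omega)
    (show m + 1 ≤ k by omega)).trans (Nat.lcmUpto_dvd_lcmUpto hk)
  -- This trades `C(n+k,k) / C(n+m+1,m+1)` for `C(n+k,k-m-1) / C(k,m+1)`, leaving three denominators
  -- that each divide one copy of the lcm.
  have hc := Nat.choose_mul (n := n + k) (k := k) (s := k - (m + 1)) (by omega)
  rw [Nat.choose_symm (show m + 1 ≤ k by omega), show k - (k - (m + 1)) = m + 1 by omega,
    show n + k - (k - (m + 1)) = n + (m + 1) by omega] at hc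
  have hx' : (Nat.lcmUpto n : ℝ) = (m + 1) * x := by exact_mod_cast hx
  have hy' : (Nat.lcmUpto n : ℝ) = (m + 1) * n.choose (m + 1) * y := by exact_mod_cast hy
  have hw' : (Nat.lcmUpto n : ℝ) = (m + 1) * k.choose (m + 1) * w := by exact_mod_cast hw
  have hc' : ((n + k).choose k : ℝ) * k.choose (m + 1) =
    (n + k).choose (k - (m + 1)) * (n + (m + 1)).choose (m + 1) := by exact_mod_cast hc
  have h₁ : (0 : ℝ) < n.choose (m + 1) := by exact_mod_cast Nat.choose_pos (by omega)
  have h₂ : (0 : ℝ) < (n + (m + 1)).choose (m + 1) := by exact_mod_cast Nat.choose_pos (by omega)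
  refine ⟨x * y * w * (n + k).choose (k - (m + 1)), ?_⟩
  push_cast
  rw [aperyBinom, ← mul_div_assoc, div_eq_iff (by positivity), pow_three]
  nth_rewrite 1 [hx']
  nth_rewrite 1 [hy']
  rw [hw']
  linear_combination ((m : ℝ) + 1) ^ 3 * x * n.choose (m + 1) * y * w * hc'

lemma exists_int_two_mul_lcmUpto_mul_aperyNum (n : ℕ) :
    ∃ z : ℤ, 2 * (Nat.lcmUpto n : ℝ) ^ 3 * aperyNum n = z := by
  let S : Subring ℝ := (Int.castRingHom ℝ).range
  suffices h : 2 * (Nat.lcmUpto n : ℝ) ^ 3 * aperyNum n ∈ S by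
    obtain ⟨z, hz⟩ := h
    exact ⟨z, by simpa using hz.symm⟩
  have hnat : ∀ a : ℕ, (a : ℝ) ∈ S := fun a => natCast_mem S a
  have hB : ∀ k, aperyBinom n k ∈ S := fun k => S.mul_mem (hnat _) (hnat _)
  rw [aperyNum, mul_sum]
  refine S.sum_mem fun k hk => ?_
  have hk' : k ≤ n := Nat.lt_succ_iff.1 (mem_range.1 hk)
  have e : 2 * (Nat.lcmUpto n : ℝ) ^ 3 * (aperyBinom n k ^ 2 * aperyWeight n k) =
      2 * aperyBinom n k ^ 2 *
        (∑ m ∈ range n, ((Nat.lcmUpto n : ℝ) / ((m + 1 : ℕ) : ℝ)) ^ 3) +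
      aperyBinom n k * n.choose k * ∑ m ∈ range k, (-1 : ℝ) ^ m *
        ((Nat.lcmUpto n : ℝ) ^ 3 * ((n + k).choose k /
          (((m : ℝ) + 1) ^ 3 * aperyBinom n (m + 1)))) := by
    rw [aperyWeight]
    simp only [mul_add, mul_sum]
    congr 1
    · refine sum_congr rfl fun m _ => ?_
      push_cast
      rw [div_pow]
      ring
    · refine sum_congr rfl fun m _ => ?_
      rw [pow_two, mul_assoc 2 (((m : ℝ) + 1) ^ 3) _, ← div_div]
      nth_rewrite 2 [aperyBinom]
      ring
  rw [e]
  refine S.add_mem (S.mul_mem (S.mul_mem (hnat 2) (S.pow_mem (hB k) 2)) (S.sum_mem fun m hm => ?_))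
    (S.mul_mem (S.mul_mem (hB k) (hnat _)) (S.sum_mem fun m hm => ?_))
  · obtain ⟨x, hx⟩ := Nat.dvd_lcmUpto (show 1 ≤ m + 1 by omega)
      (show m + 1 ≤ n from mem_range.1 hm)
    refine S.pow_mem ?_ 3
    rw [hx, Nat.cast_mul, mul_div_cancel_left₀ _ (by positivity)]
    exact hnat x
  · refine S.mul_mem (S.pow_mem (S.neg_mem S.one_mem) m) ?_
    obtain ⟨z, hz⟩ := exists_int_lcmUpto_mul_div (mem_range.1 hm) hk'
    rw [hz]
    exact intCast_mem S z

lemma exists_int_aperyDenom (n : ℕ) : ∃ z : ℤ, aperyDenom n = z :=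
  ⟨∑ k ∈ range (n + 1), ((n.choose k : ℤ) * (n + k).choose k) ^ 2, by
    simp [aperyDenom, aperyBinom]⟩

/-- **Apéry's theorem**: `ζ(3)` is irrational. -/
theorem irrational_zetaThree : Irrational zetaThree := by
  rintro ⟨r, hr⟩
  obtain ⟨K, hK, hd⟩ := Nat.exists_lcmUpto_le
  have hq : (0 : ℝ) < r.den := by exact_mod_cast r.den_pos
  have hz : zetaThree * r.den = r.num := by
    rw [← hr]
    exact_mod_cast Rat.mul_den_eq_num r
  have hbound : ∀ n : ℕ, 1 ≤ 12 * r.den * (K * (31 / 10) ^ 20) ^ 3 * (29791 / 30000 : ℝ) ^ n := by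
    intro n
    have hdp : (0 : ℝ) < Nat.lcmUpto (20 + n) := by exact_mod_cast Nat.lcmUpto_pos _
    have ha := aperyDenom_pos (20 + n)
    have hpos := sub_pos.2 (aperyNum_lt (20 + n))
    have hle := aperyDenom_mul_zetaThree_sub_le (show 20 ≤ 20 + n by omega)
    obtain ⟨b, hb⟩ := exists_int_two_mul_lcmUpto_mul_aperyNum (20 + n)
    obtain ⟨a, haz⟩ := exists_int_aperyDenom (20 + n)
    have hX : 2 * (Nat.lcmUpto (20 + n) : ℝ) ^ 3 * r.den *
        (aperyDenom (20 + n) * zetaThree - aperyNum (20 + n)) =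
        ((2 * (Nat.lcmUpto (20 + n) : ℤ) ^ 3 * a * r.num - r.den * b : ℤ) : ℝ) := by
      push_cast
      rw [← haz, ← hb, ← hz]
      ring
    have hone : (1 : ℝ) ≤ 2 * (Nat.lcmUpto (20 + n) : ℝ) ^ 3 * r.den *
        (aperyDenom (20 + n) * zetaThree - aperyNum (20 + n)) := by
      have h0 : 0 < 2 * (Nat.lcmUpto (20 + n) : ℝ) ^ 3 * r.den *
        (aperyDenom (20 + n) * zetaThree - aperyNum (20 + n)) := by positivity
      rw [hX] at h0 ⊢
      exact_mod_cast h0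
    calc (1 : ℝ) ≤ _ := hone
      _ ≤ 2 * (K * (31 / 10) ^ (20 + n)) ^ 3 * r.den * (6 / 30 ^ n) := by
          have h₁ := hd (20 + n)
          have h₂ : 6 / aperyDenom (20 + n) ≤ 6 / 30 ^ n := by
            gcongr
            exact pow_le_aperyDenom n
          have h₃ := hle.trans h₂
          gcongr
      _ = _ := by
          rw [show (29791 / 30000 : ℝ) = (31 / 10) ^ 3 / 30 by norm_num,
            div_pow ((31 / 10 : ℝ) ^ 3) 30 n, ← pow_mul, pow_add]
          ring
  have hlim : Tendsto (fun n : ℕ => 12 * r.den * (K * (31 / 10) ^ 20) ^ 3 *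
      (29791 / 30000 : ℝ) ^ n) atTop (𝓝 0) := by
    simpa using (tendsto_pow_atTop_nhds_zero_of_lt_one (by norm_num)
      (show (29791 / 30000 : ℝ) < 1 by norm_num)).const_mul
        (12 * (r.den : ℝ) * (K * (31 / 10) ^ 20) ^ 3)
  exact absurd (ge_of_tendsto' hlim hbound) (by norm_num)

/-! ### Evaluation of the series -/

lemma tendsto_sum_range_pairs {u : ℕ → ℝ} {S : ℝ} (h : HasSum u S) :
    Tendsto (fun N => ∑ n ∈ range N, (u (2 * n) + u (2 * n + 1))) atTop (𝓝 S) := by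
  have e : ∀ N, ∑ n ∈ range N, (u (2 * n) + u (2 * n + 1)) = ∑ m ∈ range (2 * N), u m := by
    intro N
    induction N with
    | zero => simp
    | succ N ih =>
      rw [sum_range_succ, ih, show 2 * (N + 1) = 2 * N + 1 + 1 by ring, sum_range_succ,
        sum_range_succ, add_assoc]
  simp only [e]
  exact h.tendsto_sum_nat.comp (tendsto_id.const_mul_atTop' two_pos)

lemma hasSum_one_div_odd_cube :
    HasSum (fun j : ℕ => 1 / (2 * (j : ℝ) + 1) ^ 3) (7 / 8 * zetaThree) := by
  rw [hasSum_iff_tendsto_nat_of_nonneg fun _ => by positivity]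
  have hs : HasSum (fun m : ℕ => 1 / ((m : ℝ) + 1) ^ 3) zetaThree :=
    (summable_one_div_succ_pow (by norm_num)).hasSum
  have h := (tendsto_sum_range_pairs hs).sub (hs.tendsto_sum_nat.const_mul (1 / 8))
  rw [show zetaThree - 1 / 8 * zetaThree = 7 / 8 * zetaThree by ring] at h
  refine h.congr fun N => ?_
  rw [mul_sum, ← sum_sub_distrib]
  refine sum_congr rfl fun n _ => ?_
  push_cast
  field_simp
  ring

lemma summable_catalan : Summable (fun j : ℕ => (-1 : ℝ) ^ j / (2 * (j : ℝ) + 1) ^ 2) := by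
  refine Summable.of_norm_bounded (summable_one_div_succ_pow one_lt_two) fun j => ?_
  rw [norm_div, norm_pow, norm_neg, norm_one, one_pow, Real.norm_of_nonneg (by positivity)]
  gcongr
  linarith [(Nat.cast_nonneg j : (0 : ℝ) ≤ j)]

lemma tendsto_sum_cubes : Tendsto (fun N => ∑ n ∈ range N,
    (1 / (4 * (n : ℝ) + 3) ^ 3 + 1 / (4 * (n : ℝ) + 5) ^ 3)) atTop
      (𝓝 (7 / 8 * zetaThree - 1)) := by
  have h := (hasSum_nat_add_iff' 1).2 hasSum_one_div_odd_cube
  have h' := tendsto_sum_range_pairs h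
  simp only [range_one, sum_singleton] at h'
  norm_num at h'
  refine h'.congr fun N => sum_congr rfl fun n _ => ?_
  norm_num
  congr 3 <;> ring

lemma tendsto_sum_squares : Tendsto (fun N => ∑ n ∈ range N,
    (1 / (4 * (n : ℝ) + 3) ^ 2 - 1 / (4 * (n : ℝ) + 5) ^ 2)) atTop
      (𝓝 (1 - catalanConstant)) := by
  have hs : HasSum (fun j : ℕ => (-1 : ℝ) ^ j / (2 * (j : ℝ) + 1) ^ 2) catalanConstant :=
    summable_catalan.hasSum
  have h := (tendsto_sum_range_pairs ((hasSum_nat_add_iff' 1).2 hs)).neg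
  simp only [range_one, sum_singleton] at h
  norm_num at h
  refine h.congr fun N => ?_
  rw [← sum_neg_distrib]
  refine sum_congr rfl fun n _ => ?_
  simp only [pow_succ, pow_mul]
  norm_num
  field_simp
  ring

/-- The odd reciprocals up to `4N - 1` sum to `H(4N) - H(2N)/2`; here `1` is missing and `1/(4N+1)`
is extra. -/
lemma sum_harmonic_eq (N : ℕ) : ∑ n ∈ range N,
    (1 / (4 * (n : ℝ) + 3) + 1 / (4 * (n : ℝ) + 5) - 2 / (4 * (n : ℝ) + 4)) =
      (harmonic (4 * N) : ℝ) + 1 / (4 * (N : ℝ) + 1) - harmonic (2 * N) / 2 - harmonic N / 2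
        - 1 := by
  induction N with
  | zero => simp
  | succ N ih =>
    rw [sum_range_succ, ih, show 4 * (N + 1) = 4 * N + 1 + 1 + 1 + 1 by ring,
      show 2 * (N + 1) = 2 * N + 1 + 1 by ring]
    simp only [harmonic_succ]
    push_cast
    field_simp
    ring

lemma tendsto_sum_harmonic : Tendsto (fun N => ∑ n ∈ range N,
    (1 / (4 * (n : ℝ) + 3) + 1 / (4 * (n : ℝ) + 5) - 2 / (4 * (n : ℝ) + 4))) atTop
      (𝓝 (3 / 2 * Real.log 2 - 1)) := by
  have h := Real.tendsto_harmonic_sub_log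
  have h₄ := h.comp (tendsto_id.const_mul_atTop' (show 0 < 4 by norm_num))
  have h₂ := h.comp (tendsto_id.const_mul_atTop' (show 0 < 2 by norm_num))
  have h₀ : Tendsto (fun N : ℕ => 1 / (4 * (N : ℝ) + 1)) atTop (𝓝 0) :=
    tendsto_const_nhds.div_atTop (tendsto_atTop_add_const_right _ _
      (tendsto_natCast_atTop_atTop.const_mul_atTop (by norm_num)))
  -- Euler's constant and `log N` cancel since `1 - 1/2 - 1/2 = 0`, leaving `log 4 - (log 2)/2`.
  have key := ((((h₄.add h₀).sub (h₂.div_const 2)).sub (h.div_const 2)).add_const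
    (3 / 2 * Real.log 2)).sub_const 1
  rw [show Real.eulerMascheroniConstant + 0 - Real.eulerMascheroniConstant / 2 -
    Real.eulerMascheroniConstant / 2 + 3 / 2 * Real.log 2 - 1 = 3 / 2 * Real.log 2 - 1 by ring] at key
  refine key.congr' ?_
  filter_upwards [eventually_gt_atTop 0] with N hN
  have hN' : (N : ℝ) ≠ 0 := by positivity
  rw [sum_harmonic_eq]
  simp only [Function.comp_apply, id_eq]
  push_cast
  rw [Real.log_mul (by norm_num) hN', Real.log_mul (by norm_num) hN',
    show (4 : ℝ) = 2 ^ 2 by norm_num, Real.log_pow]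
  push_cast
  ring

/-- The partial fraction decomposition of the summands `1/(n(16n²-1)³)`. -/
lemma partial_fractions (n : ℕ) :
    1 / (((n + 1 : ℕ) : ℝ) * (16 * ((n + 1 : ℕ) : ℝ) ^ 2 - 1) ^ 3) =
      (2 * (1 / (4 * (n : ℝ) + 3) ^ 3 + 1 / (4 * (n : ℝ) + 5) ^ 3)
        - 5 * (1 / (4 * (n : ℝ) + 3) ^ 2 - 1 / (4 * (n : ℝ) + 5) ^ 2)
        + 8 * (1 / (4 * (n : ℝ) + 3) + 1 / (4 * (n : ℝ) + 5) - 2 / (4 * (n : ℝ) + 4))) / 4 := by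
  push_cast
  rw [show 16 * ((n : ℝ) + 1) ^ 2 - 1 = (4 * n + 3) * (4 * n + 5) by ring]
  field_simp
  ring

lemma hasSum_main : HasSum
    (fun n : ℕ => 1 / (((n + 1 : ℕ) : ℝ) * (16 * ((n + 1 : ℕ) : ℝ) ^ 2 - 1) ^ 3))
    ((2 * (7 / 8 * zetaThree - 1) - 5 * (1 - catalanConstant) + 8 * (3 / 2 * Real.log 2 - 1)) / 4) := by
  have hnonneg : ∀ n : ℕ,
      0 ≤ 1 / (((n + 1 : ℕ) : ℝ) * (16 * ((n + 1 : ℕ) : ℝ) ^ 2 - 1) ^ 3) := by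
    intro n
    have : 16 * ((n + 1 : ℕ) : ℝ) ^ 2 - 1 = (4 * n + 3) * (4 * n + 5) := by push_cast; ring
    rw [this]
    positivity
  rw [hasSum_iff_tendsto_nat_of_nonneg hnonneg]
  have h := (((tendsto_sum_cubes.const_mul 2).sub (tendsto_sum_squares.const_mul 5)).add
    (tendsto_sum_harmonic.const_mul 8)).div_const 4
  refine h.congr fun N => ?_
  simp only [partial_fractions, ← sum_div, sum_add_distrib, sum_sub_distrib, ← mul_sum]

lemma ofReal_zetaThree : (zetaThree : ℂ) = riemannZeta 3 := by
  have h := zeta_nat_eq_tsum_of_gt_one (k := 3) (by norm_num)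
  have hs := Real.summable_one_div_nat_pow.2 (show 1 < 3 by norm_num)
  have e : zetaThree = ∑' n : ℕ, 1 / (n : ℝ) ^ 3 := by
    rw [hs.tsum_eq_zero_add]
    simp [zetaThree]
  rw [e]
  push_cast
  exact_mod_cast h.symm

theorem mainTheorem4 :
    Summable (fun j : ℕ => (-1 : ℝ) ^ j / (2 * (j : ℝ) + 1) ^ 2) ∧
    Summable (fun n : ℕ+ => 1 / ((n : ℝ) * (16 * (n : ℝ) ^ 2 - 1) ^ 3)) ∧
    ((4 * (∑' n : ℕ+, 1 / ((n : ℝ) * (16 * (n : ℝ) ^ 2 - 1) ^ 3))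
        - 12 * Real.log 2 - 5 * catalanConstant : ℝ) : ℂ) = 7 * riemannZeta 3 / 4 - 15 ∧
    Irrational (4 * (∑' n : ℕ+, 1 / ((n : ℝ) * (16 * (n : ℝ) ^ 2 - 1) ^ 3))
        - 12 * Real.log 2 - 5 * catalanConstant) := by
  let f : ℕ → ℝ := fun n => 1 / ((n : ℝ) * (16 * (n : ℝ) ^ 2 - 1) ^ 3)
  have hf : HasSum (fun n : ℕ => f (n + 1)) _ := hasSum_main
  have hsum : Summable (fun n : ℕ+ => f n) := summable_pnat_iff_summable_succ.2 hf.summable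
  have htsum : ∑' n : ℕ+, f n = _ := (tsum_pnat_eq_tsum_succ (f := f)).trans hf.tsum_eq
  have key : 4 * (∑' n : ℕ+, 1 / ((n : ℝ) * (16 * (n : ℝ) ^ 2 - 1) ^ 3))
      - 12 * Real.log 2 - 5 * catalanConstant = 7 / 4 * zetaThree - 15 := by
    linear_combination 4 * htsum
  refine ⟨summable_catalan, hsum, ?_, ?_⟩
  · rw [key, ← ofReal_zetaThree]
    push_cast
    ring
  · rw [key]
    have e : 7 / 4 * zetaThree - 15 = ((7 / 4 : ℚ) : ℝ) * zetaThree - ((15 : ℚ) : ℝ) := by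
      push_cast
      ring
    rw [e]
    exact (irrational_zetaThree.ratCast_mul (by norm_num)).sub_ratCast 15
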